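/- For a Boolean function $f:\{0,1\}^n\to\{0,1\}$ let $\hat f(a)=2^{-n}\sum_{x}(-1)^{f(x)\oplus a\cdot x}$ for $a\in\{0,1\}^n$, and let $\hat f_{\max}=\max_a|\hat f(a)|$. A quantum algorithm with $T$ queries to $f$ starts in a fixed basis state $|x_0,b_0,w_0\rangle$ of an input register of $n$ qubits, an output qubit and a finite-dimensional workspace, applies $U_0,O_f,U_1,O_f,\dots,O_f,U_T$, where $O_f|x,b,w\rangle=|x,b\oplus f(x),w\rangle$ and the $U_t$ are arbitrary unitaries independent of $f$, and accepts or rejects according to a measurement in the computational basis. **Theorem.** For every error bound $0\le\delta<\tfrac12$ there is a constant $c>0$, depending only on $\delta$, such that the following holds for all $n\ge 0$ and all real $\lambda>0$. 1. Suppose that some $n$-bit Boolean function has $\hat f_{\max}=1-4\lambda$. Then every quantum algorithm that, given oracle access to an $n$-bit Boolean function $f$ with the promise that $\hat f_{\max}=1$ or $\hat f_{\max}=1-4\lambda$, decides with error probability at most $\delta$ which is the case (accepting in the first case and rejecting in the second), makes at least $c/\sqrt{\lambda}$ queries. 2. Suppose that $\lambda\le\tfrac18$ and that $2\lambda\cdot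 2^n$ is an integer. Then the all-zero function has $\hat f_{\max}=1$, every $n$-bit Boolean function of Hamming weight $2\lambda\cdot 2^n$ has $\hat f_{\max}=1-4\lambda$, and already every quantum algorithm that distinguishes with error probability at most $\delta$ the all-zero function (accept) from the functions of Hamming weight $2\lambda\cdot 2^n$ (reject) makes at least $c/\sqrt{\lambda}$ queries. -/

import Mathlib

namespace QuantumQuery

/-- The `n`-bit strings `{0,1}ⁿ`, with bits in `ZMod 2` (so that `+` is XOR). -/
abbrev Bits (n : ℕ) : Type := Fin n → ZMod 2

/-- Boolean functions `{0,1}ⁿ → {0,1}`. Their Hamming weight is `hammingNorm`. -/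
abbrev BoolFun (n : ℕ) : Type := Bits n → ZMod 2

/-- The normalised Walsh coefficient `2⁻ⁿ ∑ₓ (-1)^(f(x) ⊕ a·x)`. -/
noncomputable def walsh {n : ℕ} (f : BoolFun n) (a : Bits n) : ℝ :=
  (1 / 2 ^ n) * ∑ x : Bits n, (-1 : ℝ) ^ (f x + a ⬝ᵥ x).val

/-- The largest absolute value of a Walsh coefficient of `f`. -/
noncomputable def fhatMax {n : ℕ} (f : BoolFun n) : ℝ :=
  Finset.univ.sup' Finset.univ_nonempty fun a : Bits n => |walsh f a|

/-- Labels `(x, b, w)` of the computational basis states: the query input register, the query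
output bit and a workspace of dimension `m`. -/
abbrev Label (n m : ℕ) : Type := Bits n × ZMod 2 × Fin m

/-- The oracle of `f`, i.e. the unitary `|x, b, w⟩ ↦ |x, b ⊕ f(x), w⟩`, acting on vectors of
amplitudes. -/
def oracle {n m : ℕ} (f : BoolFun n) (ψ : Label n m → ℂ) : Label n m → ℂ :=
  fun r => ψ (r.1, r.2.1 - f r.1, r.2.2)

/-- A quantum query algorithm with `queries` queries: it starts in a basis state, applies
`U 0, O_f, U 1, O_f, …, O_f, U queries` for arbitrary unitaries `U t` that do not depend on the
function `f` behind the oracle `O_f`, measures in the computational basis, and accepts iff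
the outcome lies in `accept`. (The values `U t` for `queries < t` are not used.) -/
structure Algorithm (n : ℕ) where
  queries : ℕ
  workDim : ℕ
  init : Label n workDim
  U : ℕ → Matrix.unitaryGroup (Label n workDim) ℂ
  accept : Finset (Label n workDim)

namespace Algorithm

variable {n : ℕ}

/-- The state after `t` queries to `f` and the unitary that follows them. -/
noncomputable def state (A : Algorithm n) (f : BoolFun n) : ℕ → Label n A.workDim → ℂ
  | 0 => (A.U 0 : Matrix (Label n A.workDim) (Label n A.workDim) ℂ).mulVec (Pi.single A.init 1)
  | t + 1 => (A.U (t + 1) : Matrix (Label n A.workDim) (Label n A.workDim) ℂ).mulVec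
      (oracle f (A.state f t))

/-- The probability that `A` accepts when it is run with the oracle of `f`. -/
noncomputable def acceptProb (A : Algorithm n) (f : BoolFun n) : ℝ :=
  ∑ r ∈ A.accept, ‖A.state f A.queries r‖ ^ 2

/-- `A` decides with error at most `δ` whether `f ∈ X` or `f ∈ Y`, under the promise that one of
the two holds: it accepts when `f ∈ X` and rejects when `f ∈ Y`. -/
def Decides (A : Algorithm n) (δ : ℝ) (X Y : Set (BoolFun n)) : Prop :=
  (∀ f ∈ X, 1 - A.acceptProb f ≤ δ) ∧ (∀ f ∈ Y, A.acceptProb f ≤ δ)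

end Algorithm

end QuantumQuery

/-! The zero function is hard to tell from the translates of one function `f` of weight `2λ·2ⁿ`. Any
fixed state, averaged over all shifts `s`, puts only a `2λ` fraction of its query mass on the
support of `translate f s`. By the hybrid argument along the run on `0`, the mean squared distance
between the final states after `T` queries is at most `8λT²`
(`sum_l2norm_state_translate_sub_sq_le`), whereas deciding forces each distance to be at least `(1 -
2δ)/2` (`sum_norm_sq_sub_le`).

In part 1 such an `f` arises by adding an affine function, which shifts the Walsh spectrum up to
sign and so moves an extremal coefficient to `0`; translations only change signs of coefficients. In
part 2 the weight is at most `2ⁿ/4`, which makes the coefficient at `0` the maximal one. -/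

namespace QuantumQuery

/-! ### Walsh coefficients -/

/-- The sign `(-1)^z` of a bit `z`. -/
noncomputable def bitSign (z : ZMod 2) : ℝ := (-1) ^ z.val

theorem bitSign_zero : bitSign 0 = 1 := by simp [bitSign]

theorem bitSign_one : bitSign 1 = -1 := by simp [bitSign, ZMod.val_one]

theorem zmod_two_cases (z : ZMod 2) : z = 0 ∨ z = 1 := by
  revert z; decide

theorem bitSign_add (y z : ZMod 2) : bitSign (y + z) = bitSign y * bitSign z := by
  have h : (1 + 1 : ZMod 2) = 0 := by decide
  rcases zmod_two_cases y with rfl | rfl <;> rcases zmod_two_cases z with rfl | rfl <;>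
    simp [bitSign_zero, bitSign_one, h]

theorem abs_bitSign (z : ZMod 2) : |bitSign z| = 1 := by
  simp [bitSign, abs_pow]

theorem bitSign_eq_one_sub (z : ZMod 2) : bitSign z = 1 - 2 * (if z ≠ 0 then 1 else 0) := by
  rcases zmod_two_cases z with rfl | rfl
  · simp [bitSign_zero]
  · simp [bitSign_one]; norm_num

section Walsh

variable {n : ℕ}

theorem walsh_eq_sum_bitSign (f : BoolFun n) (a : Bits n) :
    walsh f a = (1 / 2 ^ n) * ∑ x : Bits n, bitSign (f x + a ⬝ᵥ x) := rfl

theorem card_bits : (Fintype.card (Bits n) : ℝ) = 2 ^ n := by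
  simp [ZMod.card]

theorem hammingNorm_eq_sum (f : BoolFun n) :
    (hammingNorm f : ℝ) = ∑ x : Bits n, if f x ≠ 0 then (1 : ℝ) else 0 := by
  simp only [hammingNorm, Finset.sum_boole]

theorem walsh_apply_zero (f : BoolFun n) : walsh f 0 = 1 - 2 * hammingNorm f / 2 ^ n := by
  have h : ∑ x : Bits n, bitSign (f x) = 2 ^ n - 2 * hammingNorm f := by
    rw [hammingNorm_eq_sum, ← card_bits, Finset.mul_sum]
    simp_rw [bitSign_eq_one_sub]
    rw [Finset.sum_sub_distrib]
    simp
  simp only [walsh_eq_sum_bitSign, zero_dotProduct, add_zero, h]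
  field_simp

/-- Shifting `x` by a unit vector in a coordinate where `a` is `1` flips every sign, so the sum
equals its own negative. -/
theorem sum_bitSign_dotProduct_eq_zero {a : Bits n} (ha : a ≠ 0) :
    ∑ x : Bits n, bitSign (a ⬝ᵥ x) = 0 := by
  obtain ⟨i, hi⟩ := Function.ne_iff.mp ha
  have hi' : a i = 1 := (zmod_two_cases (a i)).resolve_left hi
  have h := Equiv.sum_comp (Equiv.addRight (Pi.single i 1 : Bits n))
    (fun x => bitSign (a ⬝ᵥ x))
  simp only [Equiv.coe_addRight, dotProduct_add, bitSign_add, dotProduct_single, hi', mul_one,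
    bitSign_one, mul_neg, Finset.sum_neg_distrib] at h
  linarith

theorem abs_walsh_le {f : BoolFun n} {a : Bits n} (ha : a ≠ 0) :
    |walsh f a| ≤ 2 * hammingNorm f / 2 ^ n := by
  have h : ∑ x : Bits n, bitSign (f x + a ⬝ᵥ x)
      -- After subtracting the vanishing character sum, only the support of `f` contributes.
      = -(2 * ∑ x : Bits n, (if f x ≠ 0 then 1 else 0) * bitSign (a ⬝ᵥ x)) := by
    have h0 := sum_bitSign_dotProduct_eq_zero ha
    refine Eq.trans ?_ ((congrArg (· - _) h0).trans (zero_sub _))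
    rw [Finset.mul_sum, ← Finset.sum_sub_distrib]
    refine Finset.sum_congr rfl fun x _ => ?_
    rw [bitSign_add, bitSign_eq_one_sub (f x)]
    ring
  have h' : |∑ x : Bits n, (if f x ≠ 0 then (1 : ℝ) else 0) * bitSign (a ⬝ᵥ x)|
      ≤ hammingNorm f := by
    rw [hammingNorm_eq_sum]
    refine (Finset.abs_sum_le_sum_abs _ _).trans (Finset.sum_le_sum fun x _ => ?_)
    rw [abs_mul, abs_bitSign, mul_one]
    split_ifs <;> simp
  rw [walsh_eq_sum_bitSign, h, abs_mul, abs_neg, abs_mul, abs_of_pos (by positivity),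
    abs_of_pos (by norm_num : (0 : ℝ) < 2), one_div_mul_eq_div]
  gcongr

/-- At this weight the coefficient at `0` is at least `1/2` and all others are at most `1/2` in
absolute value. -/
theorem fhatMax_eq_of_hammingNorm {f : BoolFun n} (hf : 4 * (hammingNorm f : ℝ) ≤ 2 ^ n) :
    fhatMax f = 1 - 2 * hammingNorm f / 2 ^ n := by
  have hle : 2 * (hammingNorm f : ℝ) / 2 ^ n ≤ 1 / 2 := by
    rw [div_le_iff₀ (by positivity)]
    linarith
  have h0 : |walsh f 0| = 1 - 2 * hammingNorm f / 2 ^ n := by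
    rw [walsh_apply_zero, abs_of_nonneg (by linarith)]
  refine le_antisymm (Finset.sup'_le _ _ fun a _ => ?_) ?_
  · rcases eq_or_ne a 0 with rfl | ha
    · exact h0.le
    · linarith [abs_walsh_le (f := f) ha]
  · rw [← h0]
    exact Finset.le_sup' (fun a => |walsh f a|) (Finset.mem_univ 0)

theorem fhatMax_zero : fhatMax (0 : BoolFun n) = 1 := by
  rw [fhatMax_eq_of_hammingNorm] <;> simp

theorem fhatMax_congr {f g : BoolFun n} (e : Bits n ≃ Bits n)
    (h : ∀ a, |walsh f a| = |walsh g (e a)|) : fhatMax f = fhatMax g := by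
  refine le_antisymm (Finset.sup'_le _ _ fun a _ => ?_) (Finset.sup'_le _ _ fun a _ => ?_)
  · rw [h]
    exact Finset.le_sup' (fun a => |walsh g a|) (Finset.mem_univ (e a))
  · rw [← e.apply_symm_apply a, ← h]
    exact Finset.le_sup' (fun a => |walsh f a|) (Finset.mem_univ (e.symm a))

/-- The function `x ↦ f (x ⊕ s)`. -/
def translate (f : BoolFun n) (s : Bits n) : BoolFun n := fun x => f (x + s)

theorem hammingNorm_translate (f : BoolFun n) (s : Bits n) :
    hammingNorm (translate f s) = hammingNorm f := by
  have h := Equiv.sum_comp (Equiv.addRight s) (fun x => if f x ≠ 0 then (1 : ℝ) else 0)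
  have h' := (hammingNorm_eq_sum (translate f s)).trans (h.trans (hammingNorm_eq_sum f).symm)
  exact_mod_cast h'

theorem walsh_translate (f : BoolFun n) (s a : Bits n) :
    walsh (translate f s) a = bitSign (a ⬝ᵥ s) * walsh f a := by
  have h := Equiv.sum_comp (Equiv.addRight s) (fun x => bitSign (f x + a ⬝ᵥ x))
  have hs : bitSign (a ⬝ᵥ s) * bitSign (a ⬝ᵥ s) = 1 := by
    rw [← abs_mul_abs_self, abs_bitSign, mul_one]
  rw [walsh_eq_sum_bitSign, walsh_eq_sum_bitSign, ← h, mul_left_comm,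
    Finset.mul_sum _ _ (bitSign _)]
  refine congrArg _ (Finset.sum_congr rfl fun x _ => ?_)
  simp only [translate, Equiv.coe_addRight, dotProduct_add, bitSign_add]
  linear_combination (-(bitSign (f (x + s)) * bitSign (a ⬝ᵥ x))) * hs

theorem fhatMax_translate (f : BoolFun n) (s : Bits n) : fhatMax (translate f s) = fhatMax f :=
  fhatMax_congr (Equiv.refl _) fun a => by
    rw [walsh_translate, abs_mul, abs_bitSign, one_mul, Equiv.refl_apply]

/-- The function `x ↦ f x ⊕ a·x ⊕ c`. -/
def addAffine (f : BoolFun n) (a : Bits n) (c : ZMod 2) : BoolFun n :=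
  fun x => f x + a ⬝ᵥ x + c

theorem walsh_addAffine (f : BoolFun n) (a : Bits n) (c : ZMod 2) (b : Bits n) :
    walsh (addAffine f a c) b = bitSign c * walsh f (b + a) := by
  rw [walsh_eq_sum_bitSign, walsh_eq_sum_bitSign, mul_left_comm,
    Finset.mul_sum _ _ (bitSign _)]
  refine congrArg _ (Finset.sum_congr rfl fun x _ => ?_)
  simp only [addAffine, add_dotProduct, bitSign_add]
  ring

theorem fhatMax_addAffine (f : BoolFun n) (a : Bits n) (c : ZMod 2) :
    fhatMax (addAffine f a c) = fhatMax f :=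
  fhatMax_congr (Equiv.addRight a) fun b => by
    rw [walsh_addAffine, abs_mul, abs_bitSign, one_mul, Equiv.coe_addRight]

/-- Every value of `fhatMax` is attained by a function whose coefficient at `0` is maximal. -/
theorem exists_walsh_zero_eq_fhatMax (f : BoolFun n) :
    ∃ g : BoolFun n, fhatMax g = fhatMax f ∧ walsh g 0 = fhatMax f := by
  obtain ⟨a, -, ha⟩ := Finset.exists_mem_eq_sup' (Finset.univ_nonempty (α := Bits n))
    (fun a => |walsh f a|)
  have ha' : fhatMax f = |walsh f a| := ha
  rcases abs_choice (walsh f a) with h | h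
  · exact ⟨addAffine f a 0, fhatMax_addAffine f a 0, by
      rw [walsh_addAffine, ha', h, bitSign_zero, one_mul, zero_add]⟩
  · exact ⟨addAffine f a 1, fhatMax_addAffine f a 1, by
      rw [walsh_addAffine, ha', h, bitSign_one, neg_one_mul, zero_add]⟩

theorem exists_hammingNorm_eq {k : ℕ} (hk : k ≤ 2 ^ n) : ∃ f : BoolFun n, hammingNorm f = k := by
  obtain ⟨s, hs⟩ := Finset.exists_subset_card_eq (s := (Finset.univ : Finset (Bits n))) (n := k)
    (by simpa [ZMod.card] using hk)
  refine ⟨fun x => if x ∈ s then 1 else 0, ?_⟩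
  simp [hammingNorm, hs.2]

end Walsh

/-! ### The `ℓ²` norm of amplitude vectors -/

section L2

variable {ι : Type*} [Fintype ι]

/-- The `ℓ²` norm of a vector of amplitudes. -/
noncomputable def l2norm (v : ι → ℂ) : ℝ := ‖WithLp.toLp 2 v‖

theorem l2norm_nonneg (v : ι → ℂ) : 0 ≤ l2norm v := norm_nonneg _

theorem l2norm_sq (v : ι → ℂ) : l2norm v ^ 2 = ∑ i, ‖v i‖ ^ 2 := by
  simp [l2norm, EuclideanSpace.norm_sq_eq]

theorem l2norm_eq_of_sum_eq {v w : ι → ℂ} (h : ∑ i, ‖v i‖ ^ 2 = ∑ i, ‖w i‖ ^ 2) :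
    l2norm v = l2norm w := by
  rw [← l2norm_sq, ← l2norm_sq] at h
  exact (sq_eq_sq₀ (l2norm_nonneg v) (l2norm_nonneg w)).mp h

theorem l2norm_add_le (v w : ι → ℂ) : l2norm (v + w) ≤ l2norm v + l2norm w := by
  simpa [l2norm] using norm_add_le (WithLp.toLp 2 v) (WithLp.toLp 2 w)

theorem star_dotProduct_self_eq (v : ι → ℂ) : star v ⬝ᵥ v = ((∑ i, ‖v i‖ ^ 2 : ℝ) : ℂ) := by
  simp [dotProduct, Complex.conj_mul']

theorem l2norm_unitary_mulVec [DecidableEq ι] (U : Matrix.unitaryGroup ι ℂ) (v : ι → ℂ) :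
    l2norm ((U : Matrix ι ι ℂ).mulVec v) = l2norm v := by
  apply l2norm_eq_of_sum_eq
  have hU : (U : Matrix ι ι ℂ).conjTranspose * (U : Matrix ι ι ℂ) = 1 :=
    Matrix.mem_unitaryGroup_iff'.mp U.2
  have h : star ((U : Matrix ι ι ℂ).mulVec v) ⬝ᵥ (U : Matrix ι ι ℂ).mulVec v = star v ⬝ᵥ v := by
    rw [Matrix.star_mulVec, Matrix.dotProduct_mulVec, Matrix.vecMul_vecMul, hU, Matrix.vecMul_one]
  rw [star_dotProduct_self_eq, star_dotProduct_self_eq] at h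
  exact_mod_cast h

/-- Measurement outcomes of nearby unit vectors have nearby probabilities. -/
theorem sum_norm_sq_sub_le (s : Finset ι) {v w : ι → ℂ} (hv : l2norm v = 1) (hw : l2norm w = 1) :
    ∑ i ∈ s, ‖v i‖ ^ 2 - ∑ i ∈ s, ‖w i‖ ^ 2 ≤ 2 * l2norm (w - v) := by
  have hsum : ∑ i, (‖v i‖ + ‖w i‖) ^ 2 ≤ 2 ^ 2 := by
    calc ∑ i, (‖v i‖ + ‖w i‖) ^ 2 ≤ ∑ i, (2 * ‖v i‖ ^ 2 + 2 * ‖w i‖ ^ 2) :=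
          Finset.sum_le_sum fun i _ => by nlinarith [sq_nonneg (‖v i‖ - ‖w i‖)]
      _ = 2 ^ 2 := by
          rw [Finset.sum_add_distrib, ← Finset.mul_sum, ← Finset.mul_sum, ← l2norm_sq,
            ← l2norm_sq, hv, hw]
          norm_num
  -- Each term of the difference is at most `(‖v i‖ + ‖w i‖) * ‖w i - v i‖`; the first factor has
  -- `ℓ²` norm at most `2`.
  have hCS := Finset.sum_mul_sq_le_sq_mul_sq Finset.univ (fun i => ‖v i‖ + ‖w i‖)
    (fun i => ‖w i - v i‖)
  have hd : ∑ i, ‖w i - v i‖ ^ 2 = l2norm (w - v) ^ 2 := by rw [l2norm_sq]; rfl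
  rw [hd] at hCS
  have hCS' : (∑ i, (‖v i‖ + ‖w i‖) * ‖w i - v i‖) ^ 2 ≤ (2 * l2norm (w - v)) ^ 2 := by
    rw [mul_pow]
    exact hCS.trans (by gcongr)
  have hmain := abs_le_of_sq_le_sq' hCS' (by linarith [l2norm_nonneg (w - v)])
  refine le_trans ?_ hmain.2
  rw [← Finset.sum_sub_distrib]
  calc ∑ i ∈ s, (‖v i‖ ^ 2 - ‖w i‖ ^ 2) ≤ ∑ i ∈ s, (‖v i‖ + ‖w i‖) * ‖w i - v i‖ :=
        Finset.sum_le_sum fun i _ => by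
          rw [sq_sub_sq, norm_sub_rev]
          gcongr
          exact norm_sub_norm_le _ _
    _ ≤ ∑ i, (‖v i‖ + ‖w i‖) * ‖w i - v i‖ :=
        Finset.sum_le_sum_of_subset_of_nonneg (Finset.subset_univ s) fun i _ _ => by positivity

end L2

/-! ### The oracle -/

section Oracle

variable {n m : ℕ}

/-- The permutation of the basis labels that underlies the oracle. -/
def oracleEquiv (f : BoolFun n) : Label n m ≃ Label n m where
  toFun r := (r.1, r.2.1 - f r.1, r.2.2)
  invFun r := (r.1, r.2.1 + f r.1, r.2.2)
  left_inv r := by simp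
  right_inv r := by simp

theorem oracle_apply (f : BoolFun n) (v : Label n m → ℂ) (r : Label n m) :
    oracle f v r = v (oracleEquiv f r) := rfl

theorem oracle_zero (v : Label n m → ℂ) : oracle 0 v = v := by
  funext r
  simp [oracle]

theorem l2norm_oracle (f : BoolFun n) (v : Label n m → ℂ) : l2norm (oracle f v) = l2norm v :=
  l2norm_eq_of_sum_eq (Equiv.sum_comp (oracleEquiv f) fun r => ‖v r‖ ^ 2)

/-- The oracle moves a vector by at most twice its component on queries `x` with `f x ≠ 0`. -/
theorem l2norm_oracle_sub_sq_le (f : BoolFun n) (v : Label n m → ℂ) :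
    l2norm (oracle f v - v) ^ 2 ≤ 4 * ∑ r, (if f r.1 ≠ 0 then 1 else 0) * ‖v r‖ ^ 2 := by
  have hre := Equiv.sum_comp (oracleEquiv f)
    fun r : Label n m => (if f r.1 ≠ 0 then (1 : ℝ) else 0) * ‖v r‖ ^ 2
  have hpt : ∀ r : Label n m, ‖oracle f v r - v r‖ ^ 2 ≤
      2 * ((if f (oracleEquiv f r).1 ≠ 0 then 1 else 0) * ‖v (oracleEquiv f r)‖ ^ 2) +
      2 * ((if f r.1 ≠ 0 then 1 else 0) * ‖v r‖ ^ 2) := by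
    intro r
    have h1 : (oracleEquiv f r).1 = r.1 := rfl
    rw [h1, oracle_apply]
    by_cases h : f r.1 = 0
    · have h2 : oracleEquiv f r = r := by simp [oracleEquiv, h]
      simp [h2, h]
    · simp only [ne_eq, h, not_false_eq_true, if_true, one_mul]
      have h3 := norm_sub_le (v (oracleEquiv f r)) (v r)
      have h4 := norm_nonneg (v (oracleEquiv f r) - v r)
      nlinarith [sq_nonneg (‖v (oracleEquiv f r)‖ - ‖v r‖)]
  rw [l2norm_sq]
  refine (Finset.sum_le_sum fun r _ => hpt r).trans (le_of_eq ?_)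
  rw [Finset.sum_add_distrib, ← Finset.mul_sum, ← Finset.mul_sum, hre]
  ring

/-- After exchanging the sums, each label lies over the support of exactly `hammingNorm f`
translates, whatever `v` is. -/
theorem sum_l2norm_oracle_translate_sub_sq_le (f : BoolFun n) (v : Label n m → ℂ) :
    ∑ s, l2norm (oracle (translate f s) v - v) ^ 2 ≤ 4 * hammingNorm f * l2norm v ^ 2 := by
  refine (Finset.sum_le_sum fun s _ => l2norm_oracle_sub_sq_le (translate f s) v).trans
    (le_of_eq ?_)
  rw [← Finset.mul_sum, Finset.sum_comm, mul_assoc, l2norm_sq,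
    Finset.mul_sum _ _ (hammingNorm f : ℝ)]
  refine congrArg _ (Finset.sum_congr rfl fun r _ => ?_)
  rw [← Finset.sum_mul, hammingNorm_eq_sum]
  congr 1
  exact Equiv.sum_comp (Equiv.addLeft r.1) fun x => if f x ≠ 0 then (1 : ℝ) else 0

end Oracle

/-! ### The hybrid argument -/

namespace Algorithm

variable {n : ℕ} (A : Algorithm n)

theorem l2norm_state (f : BoolFun n) (t : ℕ) : l2norm (A.state f t) = 1 := by
  induction t with
  | zero =>
    rw [state, l2norm_unitary_mulVec]
    refine (sq_eq_sq₀ (l2norm_nonneg _) zero_le_one).mp ?_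
    rw [l2norm_sq, Finset.sum_eq_single A.init (fun i _ hi => by simp [hi]) (by simp)]
    simp
  | succ t ih => rw [state, l2norm_unitary_mulVec, l2norm_oracle, ih]

/-- Hybrid argument: each query adds the error it makes on the run for `0`, and the later isometries
do not amplify it. -/
theorem l2norm_state_sub_le (f : BoolFun n) (t : ℕ) :
    l2norm (A.state f t - A.state 0 t) ≤
      ∑ i ∈ Finset.range t, l2norm (oracle f (A.state 0 i) - A.state 0 i) := by
  induction t with
  | zero => simp [state, l2norm]
  | succ t ih =>
    have h : oracle f (A.state f t) - A.state 0 t =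
        oracle f (A.state f t - A.state 0 t) + (oracle f (A.state 0 t) - A.state 0 t) := by
      funext r
      simp [oracle]
    rw [state, state, oracle_zero, ← Matrix.mulVec_sub, l2norm_unitary_mulVec, h,
      Finset.sum_range_succ]
    refine (l2norm_add_le _ _).trans ?_
    rw [l2norm_oracle]
    gcongr

theorem sum_l2norm_state_translate_sub_sq_le (f : BoolFun n) (t : ℕ) :
    ∑ s, l2norm (A.state (translate f s) t - A.state 0 t) ^ 2 ≤ 4 * t ^ 2 * hammingNorm f := by
  have h : ∀ s, l2norm (A.state (translate f s) t - A.state 0 t) ^ 2 ≤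
      t * ∑ i ∈ Finset.range t,
        l2norm (oracle (translate f s) (A.state 0 i) - A.state 0 i) ^ 2 := by
    intro s
    -- Cauchy–Schwarz over the queries gives one factor `t`; summing `t` averaged errors gives the
    -- other.
    have h1 := sq_sum_le_card_mul_sum_sq (s := Finset.range t)
      (f := fun i => l2norm (oracle (translate f s) (A.state 0 i) - A.state 0 i))
    rw [Finset.card_range] at h1
    exact (pow_le_pow_left₀ (l2norm_nonneg _) (A.l2norm_state_sub_le _ t) 2).trans h1
  refine (Finset.sum_le_sum fun s _ => h s).trans ?_
  rw [← Finset.mul_sum, Finset.sum_comm]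
  have h2 : ∑ i ∈ Finset.range t, ∑ s,
      l2norm (oracle (translate f s) (A.state 0 i) - A.state 0 i) ^ 2 ≤
      t * (4 * hammingNorm f) := by
    refine (Finset.sum_le_card_nsmul _ _ (4 * (hammingNorm f : ℝ)) fun i _ => ?_).trans_eq ?_
    · simpa [l2norm_state] using sum_l2norm_oracle_translate_sub_sq_le f (A.state 0 i)
    · simp
  refine (mul_le_mul_of_nonneg_left h2 (Nat.cast_nonneg t)).trans_eq ?_
  ring

/-- An algorithm that separates the zero function from all translates of `f` makes many queries
if the Hamming weight of `f` is small. -/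
theorem div_sqrt_le_queries {δ lam : ℝ} (hlam : 0 < lam) {f : BoolFun n}
    (hf : (hammingNorm f : ℝ) = 2 * lam * 2 ^ n) (hδ : δ < 1 / 2) (h0 : 1 - A.acceptProb 0 ≤ δ)
    (h1 : ∀ s, A.acceptProb (translate f s) ≤ δ) :
    (1 - 2 * δ) / 6 / Real.sqrt lam ≤ (A.queries : ℝ) := by
  -- The acceptance probabilities differ by at least `1 - 2δ`, and by at most twice the distance of
  -- the states.
  have hdist : ∀ s, ((1 - 2 * δ) / 2) ^ 2 ≤
      l2norm (A.state (translate f s) A.queries - A.state 0 A.queries) ^ 2 := by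
    intro s
    have h := sum_norm_sq_sub_le A.accept (A.l2norm_state 0 A.queries)
      (A.l2norm_state (translate f s) A.queries)
    have h1s := h1 s
    simp only [acceptProb] at h0 h1s
    exact pow_le_pow_left₀ (by linarith) (by linarith) 2
  have hsum := (Finset.card_nsmul_le_sum Finset.univ _ _ fun s _ => hdist s).trans
    (A.sum_l2norm_state_translate_sub_sq_le f A.queries)
  rw [nsmul_eq_mul, Finset.card_univ, card_bits, hf] at hsum
  have hpow : (0 : ℝ) < 2 ^ n := by positivity
  have hsq : ((1 - 2 * δ) / 2) ^ 2 ≤ 8 * lam * (A.queries : ℝ) ^ 2 := by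
    refine le_of_mul_le_mul_left ?_ hpow
    linarith
  rw [div_le_iff₀ (Real.sqrt_pos.mpr hlam)]
  refine (abs_le_of_sq_le_sq' ?_ (by positivity)).2
  rw [mul_pow, Real.sq_sqrt hlam.le]
  -- The constant `6` rounds up `2√8`: dividing `hsq` by `9` leaves `8/9 ≤ 1` in front of `lam *
  -- T²`.
  nlinarith [mul_nonneg hlam.le (sq_nonneg (A.queries : ℝ))]

end Algorithm

end QuantumQuery

theorem theorem6p3 (δ : ℝ) (hδ0 : 0 ≤ δ) (hδ : δ < 1 / 2) :
    ∃ c : ℝ, 0 < c ∧ ∀ (n : ℕ) (lam : ℝ), 0 < lam →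
      ((∃ f : QuantumQuery.BoolFun n, QuantumQuery.fhatMax f = 1 - 4 * lam) →
        ∀ A : QuantumQuery.Algorithm n,
          A.Decides δ {f | QuantumQuery.fhatMax f = 1}
            {f | QuantumQuery.fhatMax f = 1 - 4 * lam} →
          c / Real.sqrt lam ≤ (A.queries : ℝ)) ∧
      (lam ≤ 1 / 8 → (∃ k : ℕ, (k : ℝ) = 2 * lam * 2 ^ n) →
        QuantumQuery.fhatMax (0 : QuantumQuery.BoolFun n) = 1 ∧
        (∀ f : QuantumQuery.BoolFun n, (hammingNorm f : ℝ) = 2 * lam * 2 ^ n →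
          QuantumQuery.fhatMax f = 1 - 4 * lam) ∧
        ∀ A : QuantumQuery.Algorithm n,
          A.Decides δ {0} {f | (hammingNorm f : ℝ) = 2 * lam * 2 ^ n} →
          c / Real.sqrt lam ≤ (A.queries : ℝ)) := by
  refine ⟨(1 - 2 * δ) / 6, by linarith, fun n lam hlam => ⟨?_, ?_⟩⟩
  · rintro ⟨f, hf⟩ A ⟨hX, hY⟩
    obtain ⟨g, hg, hg0⟩ := QuantumQuery.exists_walsh_zero_eq_fhatMax f
    -- The coefficient at `0` determines the weight, here without any upper bound on `lam`.
    have hw : (hammingNorm g : ℝ) = 2 * lam * 2 ^ n := by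
      rw [hf, QuantumQuery.walsh_apply_zero] at hg0
      have h : 2 * (hammingNorm g : ℝ) / 2 ^ n = 4 * lam := by linarith
      rw [div_eq_iff (by positivity)] at h
      linarith
    exact A.div_sqrt_le_queries hlam hw hδ (hX 0 QuantumQuery.fhatMax_zero)
      fun s => hY _ ((QuantumQuery.fhatMax_translate g s).trans (hg.trans hf))
  · rintro hlam8 ⟨k, hk⟩
    have hpow : (0 : ℝ) < 2 ^ n := by positivity
    refine ⟨QuantumQuery.fhatMax_zero, fun f hf => ?_, ?_⟩
    · rw [QuantumQuery.fhatMax_eq_of_hammingNorm (by rw [hf]; nlinarith), hf]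
      field_simp
      ring
    · rintro A ⟨hX, hY⟩
      have hk' : (k : ℝ) ≤ 2 ^ n := by nlinarith
      obtain ⟨f, hf⟩ := QuantumQuery.exists_hammingNorm_eq (n := n) (k := k) (by exact_mod_cast hk')
      have hw : (hammingNorm f : ℝ) = 2 * lam * 2 ^ n := by rw [hf, hk]
      refine A.div_sqrt_le_queries hlam hw hδ (hX 0 rfl) fun s => hY _ ?_
      rw [Set.mem_ofPred_eq, QuantumQuery.hammingNorm_translate, hw]
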